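/- Let $G$ be a finite reflexive graph (every vertex is adjacent to itself, and the edge set $E(G)$ includes all loops $vv$). Then $G$ is a strong cocomparability graph if and only if its avoidance graph $G^*$ is a comparability graph. Here $G$ is a strong cocomparability graph if the rows and columns of its adjacency matrix can be permuted simultaneously (by the same permutation) so that the resulting matrix does not contain $\begin{pmatrix}0&1\\1&0\end{pmatrix}$ as a submatrix (rows and columns of a submatrix need not be consecutive, but keep their order). An edge $uu'$ of $G$ avoids an edge $vv'$ of $G$ (loops are allowed) if $\{u,u'\}\cap\{v,v'\}=\emptyset$ and one of the following holds: (i) $u=u'$, $v=v'$ and $uv\notin E(G)$; (ii) $u=u'$, $v\ne v'$ and $uv,uv'\notin E(G)$; (iii) $u\neq u'$, $v=v'$ and $uv,u'v\notin E(G)$; (iv) $u\ne u'$, $v\ne v'$ and, loops being disregarded, $\{u,u',v,v'\}$ induces a $2K_2$, a $P_4$ (path on four vertices) or a $C_4$ (cycle on four vertices) in $G$. The avoidance graph $G^*$ is the loopless graph whose vertices are the edges of $G$ (including loops), two of them being adjacent if they avoid each other. A graph is a comparability graph if its edges can be oriented, each in exactly one direction, so that whenever $xy$ and $yz$ are arcs,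 $xz$ is also an arc. -/

import Mathlib

/-- A reflexive graph: a symmetric adjacency relation in which every vertex is adjacent to itself
(and there are no multiple edges). -/
@[ext]
structure ReflexiveGraph (V : Type*) where
  /-- The adjacency relation. -/
  Adj : V → V → Prop
  symm : ∀ u v, Adj u v → Adj v u
  refl : ∀ v, Adj v v

/-- The `Slash` matrix. -/
def slashMatrix : Matrix (Fin 2) (Fin 2) ℕ :=
  !![0, 1; 1, 0]

/-- `M` contains `S` as a submatrix: some rows and some columns of `M`, taken in the order in which
they occur in `M`, form `S`. -/
def ContainsSubmatrix {n k l : ℕ} (M : Matrix (Fin n) (Fin n) ℕ) (S : Matrix (Fin k) (Fin l) ℕ) :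
    Prop :=
  ∃ (row : Fin k ↪o Fin n) (col : Fin l ↪o Fin n), M.submatrix row col = S

/-- A (loopless) graph is a comparability graph if it has a transitive orientation: every edge
receives exactly one of its two directions, and whenever `xy` and `yz` are arcs, so is `xz`. -/
def SimpleGraph.IsComparabilityGraph {W : Type*} (H : SimpleGraph W) : Prop :=
  ∃ arc : W → W → Prop,
    (∀ x y, H.Adj x y ↔ arc x y ∨ arc y x) ∧
    (∀ x y, arc x y → ¬ arc y x) ∧
    (∀ x y z, arc x y → arc y z → arc x z)

namespace ReflexiveGraph

variable {V : Type*} (G : ReflexiveGraph V)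

/-- The edges of a reflexive graph, as unordered pairs; they include all the loops. -/
def edgeSet : Set (Sym2 V) :=
  Sym2.fromRel (r := G.Adj) ⟨G.symm⟩

open Classical in
/-- The adjacency matrix. -/
noncomputable def adjMatrix : Matrix V V ℕ :=
  Matrix.of fun u v => if G.Adj u v then 1 else 0

/-- A (finite) reflexive graph is a strong cocomparability graph if, for some ordering of its
vertices, the rows and columns of the adjacency matrix, both permuted according to that ordering,
give a matrix that does not contain the `Slash` matrix as a submatrix. -/
def IsStrongCocomparabilityGraph : Prop :=
  ∃ (n : ℕ) (ordering : Fin n ≃ V),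
    ¬ ContainsSubmatrix (G.adjMatrix.submatrix ordering ordering) slashMatrix

/-- The graph without its loops. -/
def toSimpleGraph : SimpleGraph V where
  Adj u v := u ≠ v ∧ G.Adj u v
  symm := ⟨fun u v h => ⟨h.1.symm, G.symm u v h.2⟩⟩
  loopless := ⟨fun _ h => h.1 rfl⟩

/-- The vertices in `S` induce, loops being disregarded, a copy of the graph `H`. -/
def Induces {W : Type*} (S : Set V) (H : SimpleGraph W) : Prop :=
  Nonempty (G.toSimpleGraph.induce S ≃g H)

/-- The pair `uu'` avoids the pair `vv'` (meant for edges `uu'` and `vv'` of `G`). The four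
alternatives say whether each of the two edges is a loop; in the last one, the four vertices
induce a `2K₂`, a `P₄` or a `C₄`. -/
def PairAvoids (u u' v v' : V) : Prop :=
  Disjoint ({u, u'} : Set V) {v, v'} ∧
    ((u = u' ∧ v = v' ∧ ¬ G.Adj u v) ∨
      (u = u' ∧ v ≠ v' ∧ ¬ G.Adj u v ∧ ¬ G.Adj u v') ∨
      (u ≠ u' ∧ v = v' ∧ ¬ G.Adj u v ∧ ¬ G.Adj u' v) ∨
      (u ≠ u' ∧ v ≠ v' ∧
        (G.Induces {u, u', v, v'}
            ((⊤ : SimpleGraph (Fin 2)) ⊕g (⊤ : SimpleGraph (Fin 2))) ∨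
          G.Induces {u, u', v, v'} (SimpleGraph.pathGraph 4) ∨
          G.Induces {u, u', v, v'} (SimpleGraph.cycleGraph 4))))

/-- The edge `e` avoids the edge `f`. The choice of the labels of the ends does not matter. -/
def Avoids (e f : G.edgeSet) : Prop :=
  ∃ u u' v v' : V, (e : Sym2 V) = s(u, u') ∧ (f : Sym2 V) = s(v, v') ∧ G.PairAvoids u u' v v'

variable {G} in
theorem PairAvoids.symm {u u' v v' : V} (h : G.PairAvoids u u' v v') :
    G.PairAvoids v v' u u' := by
  obtain ⟨hd, h⟩ := h
  have hS : ({v, v', u, u'} : Set V) = {u, u', v, v'} := by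
    ext x
    simp only [Set.mem_insert_iff, Set.mem_singleton_iff]
    tauto
  have hn : ∀ {a b : V}, ¬ G.Adj a b → ¬ G.Adj b a := fun h h' => h (G.symm _ _ h')
  refine ⟨hd.symm, ?_⟩
  rw [hS]
  rcases h with ⟨h1, h2, h3⟩ | ⟨h1, h2, h3, h4⟩ | ⟨h1, h2, h3, h4⟩ | ⟨h1, h2, h3⟩
  · exact Or.inl ⟨h2, h1, hn h3⟩
  · exact Or.inr (Or.inr (Or.inl ⟨h2, h1, hn h3, hn h4⟩))
  · exact Or.inr (Or.inl ⟨h2, h1, hn h3, hn h4⟩)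
  · exact Or.inr (Or.inr (Or.inr ⟨h2, h1, h3⟩))

/-- The avoidance graph `G*`: its vertices are the edges of `G` (loops included), and two of them
are adjacent when they avoid each other. -/
def avoidanceGraph : SimpleGraph G.edgeSet where
  Adj e f := G.Avoids e f
  symm := ⟨by
    rintro e f ⟨u, u', v, v', he, hf, h⟩
    exact ⟨v, v', u, u', hf, he, h.symm⟩⟩
  loopless := ⟨by
    rintro e ⟨u, u', v, v', he, hf, hd, -⟩
    have hu : u ∈ s(v, v') := by
      rw [← hf, he]
      exact Sym2.mem_mk_left u u'
    refine Set.disjoint_left.mp hd (Set.mem_insert u {u'}) ?_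
    simpa [Sym2.mem_iff] using hu⟩

end ReflexiveGraph

/-!
Say that `(x, y)` forces `(p, q)` when `x ~ p`, `y ~ q`, `x ≁ q` and `y ≁ p`. An ordering is
slash-free exactly when `x < y ↔ p < q` for all such pairs (`isStrongCocomparabilityGraph_iff`), and
two edges avoid each other exactly when they can be written as `xp` and `yq` with `(x, y)` forcing
`(p, q)` (`avoids_iff`). Given a slash-free ordering, orient avoiding edges from `xp` to `yq` when
`x < y` and `p < q`; transitivity is precisely the absence of a slash.

Conversely, a transitive orientation of the avoidance graph yields a selection `T` of one direction
in each nontrivial class of the equivalence relation generated by forcing, and, through the loops, a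
transitive orientation `P` of the non-edges that `T` extends (`exists_isSelection`). A selection
without cyclic triangles is a strict partial order (`IsSelection.transitive`), and each of its
linear extensions is slash-free. The given selection may well have cyclic triangles, so another one
is built, of which only `P` survives.

* The apex of a cyclic triangle has a mirror image, and a forcing step on the opposite side carries
  the triangle to a mirror triangle with that apex (`IsOctahedral.step`, `IsPrismatic.step`). Hence
  every pair of the class of that side is the side of a cyclic triangle with one of two fixed
  apices.
* If `(a, c)` forces `(b, d)` with `P a d` and `P b c`, then `a` has to precede `c`; such pairs are
  called aligned. No class contains pairs aligned in opposite directions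
  (`IsSelection.not_isAligned_of_linked`), so the new selection can follow alignment.
* If a selection contains all aligned pairs, then any cyclic triangle lies entirely below or
  entirely above its mirror image in `P` (`IsCyclic.isLow_or_isHigh`, `IsLow.step`), and the classes
  of its sides contain no aligned pairs (`IsLow.not_isAligned`, `IsHigh.not_isAligned`).
* The classes without aligned pairs are directed so as to contain their lexicographically first
  pair with respect to a linear extension of `P`. If `x` were the first of all vertices of cyclic
  triangles and `xyz` such a triangle, then the class of `(z, x)` would contain some `(x, w)`. Both
  pairs have the apex `y`, which thus both precedes and follows `x`
  (`IsSelection.not_isCyclic_leadingSelection`).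
-/

namespace ReflexiveGraph

variable {V : Type*} {G : ReflexiveGraph V} {P T : V → V → Prop}

/-! ### Forcing between pairs of vertices -/

variable (G) in
/-- The pair `e = (x, y)` forces the pair `f = (p, q)`: the edges `xp` and `yq` avoid each other
with `x ≁ q` and `y ≁ p`, so that `x` precedes `y` in a slash-free ordering exactly when `p`
precedes `q`. -/
def Forces (e f : V × V) : Prop :=
  G.Adj e.1 f.1 ∧ G.Adj e.2 f.2 ∧ ¬ G.Adj e.1 f.2 ∧ ¬ G.Adj e.2 f.1

variable (G) in
/-- Two pairs are linked when they lie in the same class of the equivalence relation generated by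
`Forces`. -/
abbrev Linked : V × V → V × V → Prop :=
  Relation.ReflTransGen G.Forces

theorem Forces.mk {x y p q : V} (h1 : G.Adj x p) (h2 : G.Adj y q) (h3 : ¬ G.Adj x q)
    (h4 : ¬ G.Adj y p) : G.Forces (x, y) (p, q) :=
  ⟨h1, h2, h3, h4⟩

theorem Forces.symm {e f : V × V} (h : G.Forces e f) : G.Forces f e :=
  ⟨G.symm _ _ h.1, G.symm _ _ h.2.1, fun h' => h.2.2.2 (G.symm _ _ h'),
    fun h' => h.2.2.1 (G.symm _ _ h')⟩

theorem Forces.swap {e f : V × V} (h : G.Forces e f) : G.Forces e.swap f.swap :=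
  ⟨h.2.1, h.1, h.2.2.2, h.2.2.1⟩

theorem forces_self {x y : V} (h : ¬ G.Adj x y) : G.Forces (x, y) (x, y) :=
  ⟨G.refl x, G.refl y, h, fun h' => h (G.symm _ _ h')⟩

theorem Linked.symm {e f : V × V} (h : G.Linked e f) : G.Linked f e := by
  induction h with
  | refl => exact .refl
  | tail _ h2 ih => exact ih.head h2.symm

theorem Linked.swap {e f : V × V} (h : G.Linked e f) : G.Linked e.swap f.swap := by
  induction h with
  | refl => exact .refl
  | tail _ h2 ih => exact ih.tail h2.swap

theorem Linked.swap_mk {x y p q : V} (h : G.Linked (x, y) (p, q)) : G.Linked (y, x) (q, p) :=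
  h.swap

theorem Forces.linked {e f : V × V} (h : G.Forces e f) : G.Linked e f :=
  Relation.ReflTransGen.single h

/-! ### Selections -/

variable (G P T) in
/-- `T` selects one pair from each `{(x, y), (y, x)}` that takes part in forcing, consistently with
forcing, and extends the transitive orientation `P` of the non-edges of `G`. -/
structure IsSelection : Prop where
  not_adj : ∀ {x y}, P x y → ¬ G.Adj x y
  total_of_not_adj : ∀ {x y}, ¬ G.Adj x y → P x y ∨ P y x
  trans : ∀ {x y z}, P x y → P y z → P x z
  of_base : ∀ {x y}, P x y → T x y
  forces : ∀ {x y p q}, G.Forces (x, y) (p, q) → T x y → T p q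
  asymm : ∀ {x y}, T x y → ¬ T y x
  exists_forces : ∀ {x y}, T x y → ∃ p q, G.Forces (x, y) (p, q)
  total : ∀ {x y p q}, G.Forces (x, y) (p, q) → T x y ∨ T y x

namespace IsSelection

theorem linked (hT : G.IsSelection P T) {x y p q : V} (h : G.Linked (x, y) (p, q)) (hxy : T x y) :
    T p q := by
  have : ∀ f : V × V, G.Linked (x, y) f → T f.1 f.2 := by
    intro f hf
    induction hf with
    | refl => exact hxy
    | tail _ h2 ih => exact hT.forces h2 ih
  exact this _ h

theorem base_asymm (hT : G.IsSelection P T) {x y : V} (h : P x y) : ¬ P y x :=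
  fun h' => hT.asymm (hT.of_base h) (hT.of_base h')

/-- The selection with all orders reversed. -/
theorem reverse (hT : G.IsSelection P T) :
    G.IsSelection (fun x y => P y x) (fun x y => T y x) where
  not_adj h h' := hT.not_adj h (G.symm _ _ h')
  total_of_not_adj h := (hT.total_of_not_adj h).symm
  trans h1 h2 := hT.trans h2 h1
  of_base h := hT.of_base h
  forces h h' := hT.forces h.swap h'
  asymm h := hT.asymm h
  exists_forces h := by
    obtain ⟨p, q, hpq⟩ := hT.exists_forces h
    exact ⟨q, p, hpq.swap⟩
  total h := (hT.total h).symm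

/-- A class without non-edges can be reversed on its own. -/
theorem flip (hT : G.IsSelection P T) {u v : V} (huv : T u v)
    (hadj : ∀ x y, G.Linked (u, v) (x, y) → G.Adj x y) :
    G.IsSelection P (fun x y => T x y ∧ ¬ G.Linked (u, v) (x, y) ∨ G.Linked (u, v) (y, x)) where
  not_adj := hT.not_adj
  total_of_not_adj := hT.total_of_not_adj
  trans := hT.trans
  of_base h := Or.inl ⟨hT.of_base h, fun h' => hT.not_adj h (hadj _ _ h')⟩
  forces h := by
    rintro (⟨h1, h2⟩ | h1)
    · exact Or.inl ⟨hT.forces h h1, fun h3 => h2 (h3.tail h.symm)⟩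
    · exact Or.inr (h1.tail h.swap)
  asymm := by
    rintro x y (⟨h1, h2⟩ | h1) (⟨h3, h4⟩ | h3)
    · exact hT.asymm h1 h3
    · exact h2 h3
    · exact h4 h1
    · exact hT.asymm (hT.linked h1 huv) (hT.linked h3 huv)
  exists_forces := by
    rintro x y (⟨h1, _⟩ | h1)
    · exact hT.exists_forces h1
    · obtain ⟨p, q, hpq⟩ := hT.exists_forces (hT.linked h1 huv)
      exact ⟨q, p, hpq.swap⟩
  total := by
    intro x y p q h
    by_cases h1 : G.Linked (u, v) (x, y)
    · exact Or.inr (Or.inr h1)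
    by_cases h2 : G.Linked (u, v) (y, x)
    · exact Or.inl (Or.inr h2)
    exact (hT.total h).imp (fun h3 => Or.inl ⟨h3, h1⟩) (fun h3 => Or.inl ⟨h3, h2⟩)

theorem adj_right_of_adj_left (hT : G.IsSelection P T) {x y z p q : V} (hxy : T x y) (hyz : T y z)
    (h : G.Forces (x, y) (p, q)) (hz : G.Adj z p) : G.Adj z q := by
  by_contra hq
  exact hT.asymm hyz (hT.forces (Forces.mk hz h.2.1 hq h.2.2.2).symm (hT.forces h hxy))

theorem adj_left_of_adj_right (hT : G.IsSelection P T) {x y z p q : V} (hxy : T x y) (hzx : T z x)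
    (h : G.Forces (x, y) (p, q)) (hz : G.Adj z q) : G.Adj z p := by
  by_contra hp
  exact hT.asymm hzx (hT.forces (Forces.mk h.1 hz h.2.2.1 hp).symm (hT.forces h hxy))

end IsSelection

/-! ### Cyclic triangles -/

variable (T) in
/-- A cyclic triangle of the relation `T`. -/
structure IsCyclic (x y z : V) : Prop where
  fst : T x y
  snd : T y z
  thd : T z x

theorem IsCyclic.rotate {x y z : V} (h : IsCyclic T x y z) : IsCyclic T y z x :=
  ⟨h.snd, h.thd, h.fst⟩

variable (G T) in
/-- A cyclic triangle `xyz` with a mirror image `m` of its apex `z`, where `m` is adjacent to `x`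
and `y` but not to `z`, as in an octahedron. -/
structure IsOctahedral (x y z m : V) : Prop extends IsCyclic T x y z where
  adj_fst : G.Adj x m
  adj_snd : G.Adj y m
  not_adj : ¬ G.Adj z m

variable (G T) in
/-- A cyclic triangle `xyz` with a mirror image `m` of its apex `z`, where `m` is adjacent to `z`
but not to `x` or `y`, as in a triangular prism. -/
structure IsPrismatic (x y z m : V) : Prop extends IsCyclic T x y z where
  not_adj_fst : ¬ G.Adj x m
  not_adj_snd : ¬ G.Adj y m
  adj : G.Adj z m

theorem IsCyclic.exists_mirror (hT : G.IsSelection P T) {x y z : V} (h : IsCyclic T x y z) :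
    ∃ m, G.IsOctahedral T x y z m ∨ G.IsPrismatic T x y z m := by
  obtain ⟨p, q, hpq⟩ := hT.exists_forces h.fst
  obtain ⟨s, r, hsr⟩ := hT.exists_forces h.snd
  have hl := fun {p q} => hT.adj_left_of_adj_right (p := p) (q := q) h.fst h.thd
  have hr := fun {p q} => hT.adj_right_of_adj_left (p := p) (q := q) h.fst h.snd
  by_cases hz : G.Adj z q
  · refine ⟨s, Or.inl ⟨h, ?_, hsr.1, hsr.2.2.2⟩⟩
    by_contra hxs
    exact hsr.2.2.2 (hr (Forces.mk hpq.1 hsr.1 hxs hpq.2.2.2) (hl hpq hz))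
  · refine ⟨r, Or.inr ⟨h, ?_, hsr.2.2.1, hsr.2.1⟩⟩
    intro hxr
    exact hz (hr (Forces.mk hxr hpq.2.1 hpq.2.2.1 hsr.2.2.1) hsr.2.1)

/-- Forcing carries an octahedral triangle to its mirror image. -/
theorem IsOctahedral.step (hT : G.IsSelection P T) {x y z m p q : V}
    (h : G.IsOctahedral T x y z m) (hpq : G.Forces (x, y) (p, q)) :
    G.IsOctahedral T p q m z ∧ G.Forces (y, z) (m, p) ∧ G.Forces (z, x) (q, m) := by
  have hl := fun {p q} => hT.adj_left_of_adj_right (p := p) (q := q) h.fst h.thd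
  have hr := fun {p q} => hT.adj_right_of_adj_left (p := p) (q := q) h.fst h.snd
  have hzq : G.Adj z q := by
    by_contra hzq
    obtain ⟨s, r, hsr⟩ := hT.exists_forces h.snd
    by_cases hxr : G.Adj x r
    · exact hzq (hr (Forces.mk hxr hpq.2.1 hpq.2.2.1 hsr.2.2.1) hsr.2.1)
    · have h1 : G.Forces (y, z) (m, r) := Forces.mk h.adj_snd hsr.2.1 hsr.2.2.1 h.not_adj
      have h2 : G.Forces (x, z) (m, r) := Forces.mk h.adj_fst hsr.2.1 hxr h.not_adj
      exact hT.asymm h.thd (hT.forces h2.symm (hT.forces h1 h.snd))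
  have hzp := hl hpq hzq
  have h1 : G.Forces (y, z) (m, p) := Forces.mk h.adj_snd hzp hpq.2.2.2 h.not_adj
  have h2 : G.Forces (z, x) (q, m) := Forces.mk hzq h.adj_fst h.not_adj hpq.2.2.1
  exact ⟨⟨⟨hT.forces hpq h.fst, hT.forces h2 h.thd, hT.forces h1 h.snd⟩, G.symm _ _ hzp,
    G.symm _ _ hzq, fun h' => h.not_adj (G.symm _ _ h')⟩, h1, h2⟩

/-- Forcing carries a prismatic triangle to its mirror image. -/
theorem IsPrismatic.step (hT : G.IsSelection P T) {x y z m p q : V}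
    (h : G.IsPrismatic T x y z m) (hpq : G.Forces (x, y) (p, q)) :
    G.IsPrismatic T p q m z := by
  have hl := fun {p q} => hT.adj_left_of_adj_right (p := p) (q := q) h.fst h.thd
  have hr := fun {p q} => hT.adj_right_of_adj_left (p := p) (q := q) h.fst h.snd
  have hzp : ¬ G.Adj z p := by
    intro hzp
    obtain ⟨s, r, hsr⟩ := hT.exists_forces h.snd
    by_cases hxs : G.Adj x s
    · have h1 : G.Forces (y, z) (s, m) := Forces.mk hsr.1 h.adj h.not_adj_snd hsr.2.2.2
      have h2 : G.Forces (x, z) (s, m) := Forces.mk hxs h.adj h.not_adj_fst hsr.2.2.2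
      exact hT.asymm h.thd (hT.forces h2.symm (hT.forces h1 h.snd))
    · exact hsr.2.2.2 (hr (Forces.mk hpq.1 hsr.1 hxs hpq.2.2.2) hzp)
  have hzq : ¬ G.Adj z q := fun h' => hzp (hl hpq h')
  have h1 : G.Forces (y, z) (q, m) := Forces.mk hpq.2.1 h.adj h.not_adj_snd hzq
  have h2 : G.Forces (z, x) (m, p) := Forces.mk h.adj hpq.1 hzp h.not_adj_fst
  exact ⟨⟨hT.forces hpq h.fst, hT.forces h1 h.snd, hT.forces h2 h.thd⟩,
    fun h' => hzp (G.symm _ _ h'), fun h' => hzq (G.symm _ _ h'), G.symm _ _ h.adj⟩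

/-- A selection without cyclic triangles is transitive. -/
theorem IsSelection.transitive (hT : G.IsSelection P T) (hcyc : ∀ x y z, ¬ IsCyclic T x y z)
    {x y z : V} (hxy : T x y) (hyz : T y z) : T x z := by
  suffices ∃ p q, G.Forces (x, z) (p, q) by
    obtain ⟨p, q, h⟩ := this
    exact (hT.total h).resolve_right fun h' => hcyc x y z ⟨hxy, hyz, h'⟩
  have hr := fun {p q} => hT.adj_right_of_adj_left (p := p) (q := q) hxy hyz
  obtain ⟨p, q, hpq⟩ := hT.exists_forces hxy
  obtain ⟨s, r, hsr⟩ := hT.exists_forces hyz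
  by_cases hzp : G.Adj z p
  · have hzq := hr hpq hzp
    refine ⟨s, q, Forces.mk ?_ hzq hpq.2.2.1 hsr.2.2.2⟩
    by_contra hxs
    exact hsr.2.2.2 (hr (Forces.mk hpq.1 hsr.1 hxs hpq.2.2.2) hzp)
  by_cases hzq : G.Adj z q
  · exact ⟨p, q, Forces.mk hpq.1 hzq hpq.2.2.1 hzp⟩
  refine ⟨p, r, Forces.mk hpq.1 hsr.2.1 ?_ hzp⟩
  intro hxr
  exact hzq (hr (Forces.mk hxr hpq.2.1 hpq.2.2.1 hsr.2.2.1) hsr.2.1)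

theorem IsOctahedral.self (hT : G.IsSelection P T) {x y z m : V} (h : G.IsOctahedral T x y z m)
    (hxy : ¬ G.Adj x y) : G.IsOctahedral T x y m z :=
  (h.step hT (forces_self hxy)).1

/-- Every pair of the class of `(x, y)` has apex `z` or `m`, and the two other sides of the resulting
triangle stay in their classes. -/
theorem IsOctahedral.linked (hT : G.IsSelection P T) {x y z m : V} (h : G.IsOctahedral T x y z m)
    {e : V × V} (he : G.Linked (x, y) e) :
    (G.IsOctahedral T e.1 e.2 z m ∧ G.Linked (y, z) (e.2, z) ∧ G.Linked (z, x) (z, e.1)) ∨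
      (G.IsOctahedral T e.1 e.2 m z ∧ G.Linked (y, z) (m, e.1) ∧ G.Linked (z, x) (e.2, m)) := by
  induction he with
  | refl => exact Or.inl ⟨h, .refl, .refl⟩
  | tail _ h2 ih =>
    rcases ih with ⟨h3, h4, h5⟩ | ⟨h3, h4, h5⟩
    · obtain ⟨h6, h7, h8⟩ := h3.step hT h2
      exact Or.inr ⟨h6, h4.tail h7, h5.tail h8⟩
    · obtain ⟨h6, h7, h8⟩ := h3.step hT h2
      exact Or.inl ⟨h6, h4.tail h8, h5.tail h7⟩

/-- Once both `z` and `m` serve as apex of one pair, they do so for its whole class. -/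
theorem IsOctahedral.linked_both (hT : G.IsSelection P T) {x y z m : V}
    (h : G.IsOctahedral T x y z m) (h' : G.IsOctahedral T x y m z) {e : V × V}
    (he : G.Linked (x, y) e) : G.IsOctahedral T e.1 e.2 z m ∧ G.IsOctahedral T e.1 e.2 m z := by
  induction he with
  | refl => exact ⟨h, h'⟩
  | tail _ h2 ih => exact ⟨(ih.2.step hT h2).1, (ih.1.step hT h2).1⟩

/-! ### Aligned pairs -/

variable (G P) in
/-- The pair `(a, c)` is aligned with `P` when some avoiding edges `ab` and `cd` with non-edges
`ad` and `bc` satisfy `P a d` and `P b c`: every slash-free ordering that extends `P` then puts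
`a` before `c`. -/
def IsAligned (a c : V) : Prop :=
  ∃ b d, G.Forces (a, c) (b, d) ∧ P a d ∧ P b c

theorem isAligned_reverse {a c : V} : G.IsAligned (fun x y => P y x) a c ↔ G.IsAligned P c a := by
  constructor <;>
  · rintro ⟨b, d, h1, h2, h3⟩
    exact ⟨d, b, h1.swap, h3, h2⟩

/-- In a cyclic triangle `xyz` with `P y z`, the class of `(x, y)` contains no non-edge. -/
theorem IsCyclic.adj_of_linked (hT : G.IsSelection P T) {x y z h g : V} (hc : IsCyclic T x y z)
    (hyz : P y z) (hxy : G.Adj x y) (hl : G.Linked (x, y) (h, g)) : G.Adj h g := by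
  by_contra hhg
  have hzy : ¬ G.Adj z y := fun h' => hT.not_adj hyz (G.symm _ _ h')
  have h0 : G.IsOctahedral T x y z y := ⟨hc, hxy, G.refl y, hzy⟩
  obtain ⟨h1, h2, h3⟩ : G.IsOctahedral T h g z y ∧ G.IsOctahedral T h g y z ∧
      G.Linked (y, z) (g, z) := by
    rcases h0.linked hT hl with ⟨h1, h2, -⟩ | ⟨h1, h2, -⟩
    · exact ⟨h1, h1.self hT hhg, h2⟩
    · obtain ⟨h3, -, h5⟩ := h1.step hT (forces_self hhg)
      exact ⟨h3, h1, h2.tail h5⟩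
  -- The triangle `hgz`, read with apex `h`, is carried back to `(y, z)`.
  have h4 : G.IsOctahedral T g z h g := ⟨h1.toIsCyclic.rotate, G.refl g, G.symm _ _ h2.adj_snd, hhg⟩
  have h5 : T h y := by
    rcases h4.linked hT h3.symm with ⟨h5, -⟩ | ⟨h5, -⟩
    · exact h5.thd
    · exact (h5.self hT (hT.not_adj hyz)).thd
  exact hT.asymm h5 h2.thd

/-- A pair of `T` whose class contains a non-edge is not aligned the other way. -/
theorem IsSelection.not_isAligned_of_not_adj (hT : G.IsSelection P T) {a c h g : V} (hac : T a c)
    (hl : G.Linked (a, c) (h, g)) (hhg : ¬ G.Adj h g) : ¬ G.IsAligned P c a := by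
  rintro ⟨d, b, hf, hcb, hda⟩
  have hf' : G.Forces (a, c) (b, d) := hf.swap
  have hbd : T b d := hT.forces hf' hac
  have h1 : G.Adj a c := by
    by_contra h
    rcases hT.total_of_not_adj h with h | h
    · exact hT.not_adj (hT.trans hda h) (G.symm _ _ hf'.2.1)
    · exact hT.asymm hac (hT.of_base h)
  have h2 : G.Adj b d := by
    by_contra h
    rcases hT.total_of_not_adj h with h | h
    · exact hT.not_adj (hT.trans hcb h) hf'.2.1
    · exact hT.asymm hbd (hT.of_base h)
  have h3 : G.Forces (a, b) (c, d) :=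
    Forces.mk h1 h2 (fun h => hT.not_adj hda (G.symm _ _ h)) fun h =>
      hT.not_adj hcb (G.symm _ _ h)
  rcases hT.total h3 with h | h
  · exact hhg (IsCyclic.adj_of_linked hT (IsCyclic.rotate ⟨h, hbd, hT.of_base hda⟩) hda h2
      (hf'.symm.linked.trans hl))
  · exact hhg (IsCyclic.adj_of_linked hT ⟨hac, hT.of_base hcb, h⟩ hcb h1 hl)

/-- If the class of a non-edge `(p, v)` contains no two consecutive pairs, then it forces only along
non-edges that point the same way as `(p, v)`. -/
theorem IsSelection.base_of_linked (hT : G.IsSelection P T) {p v : V} (hpv : P p v)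
    (hchain : ∀ x y z, G.Linked (p, v) (x, y) → ¬ G.Linked (p, v) (y, z))
    {e : V × V} (he : G.Linked (p, v) e) :
    ∀ b d, G.Forces e (b, d) → P e.1 d ∧ P b e.2 := by
  have hbase : ∀ {x y}, G.Linked (p, v) (x, y) → ¬ G.Adj x y → P x y := by
    intro x y hl hn
    refine (hT.total_of_not_adj hn).resolve_right fun h' => ?_
    exact hT.asymm (hT.of_base h') (hT.linked hl (hT.of_base hpv))
  induction he with
  | refl =>
    intro b d h
    constructor
    · refine (hT.total_of_not_adj h.2.2.1).resolve_right fun h' => ?_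
      exact hT.not_adj (hT.trans h' hpv) (G.symm _ _ h.2.1)
    · refine (hT.total_of_not_adj h.2.2.2).resolve_left fun h' => ?_
      exact hT.not_adj (hT.trans hpv h') h.1
  | @tail e f he hef ih =>
    obtain ⟨h, g⟩ := e
    obtain ⟨k, l⟩ := f
    obtain ⟨h1, h2⟩ := ih k l hef
    have hf : G.Linked (p, v) (k, l) := he.tail hef
    obtain ⟨e1, e2, e3, e4⟩ := hef
    intro b d ⟨f1, f2, f3, f4⟩
    dsimp only at *
    constructor
    · refine (hT.total_of_not_adj f3).resolve_right fun h' => ?_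
      have h3 : G.Linked (p, v) (h, d) := hf.tail (Forces.mk (G.symm _ _ e1) f2 f3
        fun h5 => e3 (G.symm _ _ h5))
      have h4 : G.Adj h d := by
        by_contra h5
        exact hT.not_adj (hT.trans (hbase h3 h5) h') e1
      refine hchain _ _ _ h3 (he.tail (Forces.mk (y := l) (x := d) (G.symm _ _ h4) (G.symm _ _ e2)
        (hT.not_adj (hT.trans h' h2)) fun h5 => e3 (G.symm _ _ h5)).symm)
    · refine (hT.total_of_not_adj f4).resolve_left fun h' => ?_
      have h3 : G.Linked (p, v) (b, g) := hf.tail (Forces.mk f1 (G.symm _ _ e2)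
        (fun h5 => e4 (G.symm _ _ h5)) f4)
      have h4 : G.Adj b g := by
        by_contra h5
        exact hT.not_adj (hT.trans h' (hbase h3 h5)) (G.symm _ _ e2)
      refine hchain _ _ _ (he.tail (Forces.mk (x := k) (y := b) (G.symm _ _ e1) h4
        (fun h5 => e4 (G.symm _ _ h5)) ?_).symm) h3
      exact fun h5 => hT.not_adj (hT.trans h1 h') (G.symm _ _ h5)

/-- The key step towards the consistency of alignment: `u` lies between its non-neighbours `d` and
`d'`, and `P p v` for some `p`. Then no pair of the class of `(u, v)` is aligned backwards. -/
theorem IsSelection.not_isAligned_of_between (hT : G.IsSelection P T) {u v d d' p x y : V}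
    (hadj : ∀ a c, G.Linked (u, v) (a, c) → G.Adj a c) (hvu : T v u)
    (hdu : P d u) (hud : P u d') (hvd : G.Adj v d) (hvd' : G.Adj v d') (hup : G.Adj u p)
    (hpv : P p v) (hl : G.Linked (u, v) (x, y)) : ¬ G.IsAligned P y x := by
  rintro ⟨s, r, hf, hyr, hsx⟩
  have hvp : ¬ G.Adj v p := fun h => hT.not_adj hpv (G.symm _ _ h)
  have hud0 : ¬ G.Adj u d := fun h => hT.not_adj hdu (G.symm _ _ h)
  have hf1 : G.Forces (u, v) (p, d) := Forces.mk hup hvd hud0 hvp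
  have hf2 : G.Forces (u, v) (p, d') := Forces.mk hup hvd' (hT.not_adj hud) hvp
  have huv : G.Adj u v := hadj _ _ .refl
  have hpd : G.Adj p d := hadj _ _ hf1.linked
  have hpd' : G.Adj p d' := hadj _ _ hf2.linked
  -- Both `(p, u)` and `(u, v)` belong to the class: `(u, v)`, `(p, d)`, `(d', v)`, `(p, u)`.
  have hdd' : ¬ G.Adj d d' := hT.not_adj (hT.trans hdu hud)
  have hf3 : G.Forces (p, d) (d', v) :=
    Forces.mk hpd' (G.symm _ _ hvd) (hT.not_adj hpv) hdd'
  have hf4 : G.Forces (d', v) (p, u) :=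
    Forces.mk (G.symm _ _ hpd') (G.symm _ _ huv) (fun h => hT.not_adj hud (G.symm _ _ h)) hvp
  have hpu : G.Linked (u, v) (p, u) := ((hf1.linked.tail hf3).tail hf4)
  have hup' : T u p := hT.linked hpu.swap_mk hvu
  have hcyc : IsCyclic T v u p := ⟨hvu, hup', hT.of_base hpv⟩
  have hO : G.IsOctahedral T v u p v := ⟨hcyc, G.refl v, huv, hT.not_adj hpv⟩
  have hO1 : G.IsOctahedral T p v u d := ⟨hcyc.rotate.rotate, hpd, hvd, hud0⟩
  have hO2 := hO1.self hT (hT.not_adj hpv)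
  -- Every pair of the class of `(p, v)` has `u` as an apex, so `u` separates sources from sinks.
  have hchain : ∀ a b c, G.Linked (p, v) (a, b) → ¬ G.Linked (p, v) (b, c) := by
    intro a b c h1 h2
    exact hT.asymm (hO1.linked_both hT hO2 h1).1.snd (hO1.linked_both hT hO2 h2).1.thd
  have hbase := fun e he => hT.base_of_linked hpv hchain (e := e) he
  rcases hO.linked hT hl.swap_mk with ⟨h1, -, h3⟩ | ⟨h1, -, h3⟩
  · obtain ⟨-, -, h5⟩ := h1.step hT hf
    exact hT.base_asymm hyr (hbase _ h3 _ _ h5).2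
  · obtain ⟨-, h5, -⟩ := h1.step hT hf
    exact hT.base_asymm hsx (hbase _ h3 _ _ h5).1

theorem IsSelection.exists_flip (hT : G.IsSelection P T) {u v : V} (huv : T u v ∨ T v u)
    (hadj : ∀ a c, G.Linked (u, v) (a, c) → G.Adj a c) : ∃ T', G.IsSelection P T' ∧ T' v u := by
  rcases huv with h | h
  · exact ⟨_, hT.flip h hadj, Or.inr .refl⟩
  · exact ⟨T, hT, h⟩

/-- In a class without non-edges that contains pairs aligned in both directions, no first vertex `u`
of a pair `(u, v)` lies between two non-neighbours of `u` that are neighbours of `v`. -/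
theorem IsSelection.not_between (hT : G.IsSelection P T) {u v d d' x y x' y' : V}
    (huv : T u v ∨ T v u) (hadj : ∀ a c, G.Linked (u, v) (a, c) → G.Adj a c)
    (hl : G.Linked (u, v) (x, y)) (hxy : G.IsAligned P x y)
    (hl' : G.Linked (u, v) (x', y')) (hxy' : G.IsAligned P y' x')
    (hvd : G.Adj v d) (hvd' : G.Adj v d') (hdu : P d u) : ¬ P u d' := by
  intro hud
  obtain ⟨p, hup, hvp⟩ : ∃ p, G.Adj u p ∧ ¬ G.Adj v p := by
    rcases huv with h | h
    · obtain ⟨p, q, hpq⟩ := hT.exists_forces h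
      exact ⟨p, hpq.1, hpq.2.2.2⟩
    · obtain ⟨q, p, hpq⟩ := hT.exists_forces h
      exact ⟨p, hpq.2.1, hpq.2.2.1⟩
  rcases hT.total_of_not_adj hvp with hp | hp
  · obtain ⟨T', hT', h'⟩ := hT.exists_flip huv.symm fun a c h => G.symm _ _ (hadj _ _ h.swap_mk)
    exact hT'.reverse.not_isAligned_of_between hadj h' hud hdu hvd' hvd hup hp hl
      (isAligned_reverse.2 hxy)
  · obtain ⟨T', hT', h'⟩ := hT.exists_flip huv hadj
    exact hT'.not_isAligned_of_between hadj h' hdu hud hvd hvd' hup hp hl' hxy'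

/-- Alignment is consistent: a class that contains an aligned pair contains no pair that is aligned
backwards. -/
theorem IsSelection.not_isAligned_of_linked (hT : G.IsSelection P T) {a c a' c' : V}
    (h : G.IsAligned P a c) (hl : G.Linked (a, c) (a', c')) : ¬ G.IsAligned P c' a' := by
  intro h'
  have hac : T a c ∨ T c a := by
    obtain ⟨b, d, hf, -⟩ := h
    exact hT.total hf
  by_cases hadj : ∀ x y, G.Linked (a, c) (x, y) → G.Adj x y
  swap
  · push Not at hadj
    obtain ⟨x, y, hxy, hn⟩ := hadj
    rcases hac with hac | hac
    · exact hT.not_isAligned_of_not_adj (hT.linked hl hac) (hl.symm.trans hxy) hn h'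
    · exact hT.not_isAligned_of_not_adj hac hxy.swap_mk (fun h => hn (G.symm _ _ h)) h
  -- Since no vertex lies between two of its relevant non-neighbours, one witness of alignment
  -- decides all of them, and alignment spreads along the class.
  have hstep : ∀ u v b₀ d₀, G.Linked (a, c) (u, v) → G.Forces (u, v) (b₀, d₀) → P u d₀ → P b₀ v →
      ∀ b d, G.Forces (u, v) (b, d) → P u d ∧ P b v := by
    intro u v b₀ d₀ huv hf₀ h1 h2 b d hf
    have hT' := hac.imp (hT.linked huv) (hT.linked huv.swap_mk)
    have hadj' : ∀ x y, G.Linked (u, v) (x, y) → G.Adj x y := fun x y hxy =>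
      hadj _ _ (huv.trans hxy)
    constructor
    · refine (hT.total_of_not_adj hf.2.2.1).resolve_right fun h3 => ?_
      exact hT.not_between hT' hadj' huv.symm h (huv.symm.trans hl) h' hf.2.1 hf₀.2.1 h3 h1
    · refine (hT.total_of_not_adj hf.2.2.2).resolve_left fun h3 => ?_
      exact hT.not_between hT'.symm (fun x y hxy => G.symm _ _ (hadj' _ _ hxy.swap_mk))
        (Linked.swap_mk (huv.symm.trans hl)) h' huv.symm.swap_mk h hf₀.1 hf.1 h2 h3
  have hall : ∀ e : V × V, G.Linked (a, c) e → ∀ b d, G.Forces e (b, d) → P e.1 d ∧ P b e.2 := by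
    intro e he
    induction he with
    | refl =>
      obtain ⟨b₀, d₀, hf, h1, h2⟩ := h
      exact hstep _ _ _ _ .refl hf h1 h2
    | @tail e f he hef ih =>
      obtain ⟨h1, h2⟩ := ih _ _ hef
      exact hstep _ _ _ _ (he.tail hef) hef.symm h2 h1
  obtain ⟨d, b, hf, h1, h2⟩ := h'
  exact hT.base_asymm h1 (hall _ hl _ _ hf.swap).2

/-! ### Low and high triangles -/

variable (G P T) in
/-- A cyclic triangle with mirror image `m` of its apex that lies below its mirror image. Only the
non-edges at `m` are recorded; for a selection that contains all aligned pairs they decide the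
remaining ones, see `IsLow.step`. -/
def IsLow (x y z m : V) : Prop :=
  G.IsOctahedral T x y z m ∧ P z m ∨ G.IsPrismatic T x y z m ∧ P x m ∧ P y m

variable (G P T) in
/-- A cyclic triangle with mirror image `m` of its apex that lies above its mirror image, encoded
as in `IsLow`. -/
def IsHigh (x y z m : V) : Prop :=
  G.IsOctahedral T x y z m ∧ P m z ∨ G.IsPrismatic T x y z m ∧ P m x ∧ P m y

theorem IsCyclic.reverse {x y z : V} (h : IsCyclic T x y z) :
    IsCyclic (fun a b => T b a) y x z :=
  ⟨h.fst, h.thd, h.snd⟩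

theorem IsOctahedral.reverse {x y z m : V} (h : G.IsOctahedral T x y z m) :
    G.IsOctahedral (fun a b => T b a) y x z m :=
  ⟨h.toIsCyclic.reverse, h.adj_snd, h.adj_fst, h.not_adj⟩

theorem IsPrismatic.reverse {x y z m : V} (h : G.IsPrismatic T x y z m) :
    G.IsPrismatic (fun a b => T b a) y x z m :=
  ⟨h.toIsCyclic.reverse, h.not_adj_snd, h.not_adj_fst, h.adj⟩

theorem IsHigh.reverse {x y z m : V} (h : G.IsHigh P T x y z m) :
    G.IsLow (fun a b => P b a) (fun a b => T b a) y x z m :=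
  h.imp (fun h => ⟨h.1.reverse, h.2⟩) fun h => ⟨h.1.reverse, h.2.2, h.2.1⟩

theorem IsLow.isCyclic {x y z m : V} (h : G.IsLow P T x y z m) : IsCyclic T x y z :=
  h.elim (fun h => h.1.toIsCyclic) fun h => h.1.toIsCyclic

theorem IsHigh.isCyclic {x y z m : V} (h : G.IsHigh P T x y z m) : IsCyclic T x y z :=
  h.elim (fun h => h.1.toIsCyclic) fun h => h.1.toIsCyclic

/-- The vertices of a prismatic triangle are pairwise adjacent. -/
theorem IsPrismatic.pairwise_adj (hT : G.IsSelection P T) {x y z m : V}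
    (h : G.IsPrismatic T x y z m) : G.Adj x y ∧ G.Adj y z ∧ G.Adj z x := by
  have hbase : ∀ {a b}, T a b → ¬ G.Adj a b → P a b := fun hab hn =>
    (hT.total_of_not_adj hn).resolve_right fun h' => hT.asymm hab (hT.of_base h')
  have hxy : G.Adj x y := by
    by_contra hn
    have h' := h.step hT (forces_self hn)
    exact hT.base_asymm (hbase h.fst hn) (hT.trans (hbase h.snd h'.not_adj_snd)
      (hbase h.thd fun h'' => h'.not_adj_fst (G.symm _ _ h'')))
  refine ⟨hxy, ?_, ?_⟩
  · by_contra hn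
    exact h.not_adj_fst (hT.adj_right_of_adj_left h.snd h.thd
      (Forces.mk (G.refl y) h.adj h.not_adj_snd fun h' => hn (G.symm _ _ h')) hxy)
  · by_contra hn
    exact h.not_adj_snd (hT.adj_left_of_adj_right h.thd h.snd
      (Forces.mk h.adj (G.refl x) hn h.not_adj_fst) (G.symm _ _ hxy))

theorem IsLow.step (hT : G.IsSelection P T) (hA : ∀ a c, G.IsAligned P a c → T a c)
    {x y z m p q : V} (h : G.IsLow P T x y z m) (hpq : G.Forces (x, y) (p, q)) :
    G.IsHigh P T p q m z ∧ P x q ∧ P y p := by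
  rcases h with ⟨h, hzm⟩ | ⟨h, hxm, hym⟩
  · obtain ⟨h1, h2, -⟩ := h.step hT hpq
    have hyp : P y p := by
      refine (hT.total_of_not_adj hpq.2.2.2).resolve_right fun h' => ?_
      exact hT.asymm h.snd (hA _ _ ⟨p, m, h2.swap, hzm, h'⟩)
    refine ⟨Or.inl ⟨h1, hzm⟩, ?_, hyp⟩
    refine (hT.total_of_not_adj hpq.2.2.1).resolve_right fun h' => ?_
    exact hT.asymm h.fst (hA _ _ ⟨q, p, hpq.swap, hyp, h'⟩)
  · have h1 := h.step hT hpq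
    obtain ⟨a1, a2, a3⟩ := h.pairwise_adj hT
    obtain ⟨b1, b2, b3⟩ := h1.pairwise_adj hT
    -- Non-edges form the hexagon `x m y p z q`, around which the orientation alternates.
    have hyp : P y p := (hT.total_of_not_adj hpq.2.2.2).resolve_right fun h' =>
      hT.not_adj (hT.trans h' hym) (G.symm _ _ b3)
    have hzp : P z p := (hT.total_of_not_adj h1.not_adj_fst).resolve_left fun h' =>
      hT.not_adj (hT.trans hyp h') a2
    have hzq : P z q := (hT.total_of_not_adj h1.not_adj_snd).resolve_left fun h' =>
      hT.not_adj (hT.trans h' hzp) (G.symm _ _ b1)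
    have hxq : P x q := (hT.total_of_not_adj hpq.2.2.1).resolve_right fun h' =>
      hT.not_adj (hT.trans hzq h') a3
    exact ⟨Or.inr ⟨h1, hzp, hzq⟩, hxq, hyp⟩

theorem IsHigh.step (hT : G.IsSelection P T) (hA : ∀ a c, G.IsAligned P a c → T a c)
    {x y z m p q : V} (h : G.IsHigh P T x y z m) (hpq : G.Forces (x, y) (p, q)) :
    G.IsLow P T p q m z ∧ P q x ∧ P p y := by
  obtain ⟨h1, h2, h3⟩ := h.reverse.step hT.reverse (fun a c hac => hA _ _
    (isAligned_reverse.1 hac)) hpq.swap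
  exact ⟨h1.reverse, h3, h2⟩

theorem IsLow.linked (hT : G.IsSelection P T) (hA : ∀ a c, G.IsAligned P a c → T a c)
    {x y z m : V} (h : G.IsLow P T x y z m) {e : V × V} (he : G.Linked (x, y) e) :
    G.IsLow P T e.1 e.2 z m ∨ G.IsHigh P T e.1 e.2 m z := by
  induction he with
  | refl => exact Or.inl h
  | tail _ h2 ih =>
    rcases ih with h3 | h3
    · exact Or.inr (h3.step hT hA h2).1
    · exact Or.inl (h3.step hT hA h2).1

theorem IsLow.not_isAligned (hT : G.IsSelection P T) (hA : ∀ a c, G.IsAligned P a c → T a c)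
    {x y z m : V} (h : G.IsLow P T x y z m) : ¬ G.IsAligned P x y := by
  rintro ⟨b, d, hf, -, h2⟩
  exact hT.base_asymm h2 (h.step hT hA hf).2.2

theorem IsHigh.not_isAligned (hT : G.IsSelection P T) (hA : ∀ a c, G.IsAligned P a c → T a c)
    {x y z m : V} (h : G.IsHigh P T x y z m) : ¬ G.IsAligned P x y := by
  rintro ⟨b, d, hf, h1, -⟩
  exact hT.base_asymm h1 (h.step hT hA hf).2.1

theorem IsCyclic.isLow_or_isHigh (hT : G.IsSelection P T) {x y z : V} (h : IsCyclic T x y z) :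
    ∃ m, G.IsLow P T x y z m ∨ G.IsHigh P T x y z m := by
  obtain ⟨m, hm | hm⟩ := h.exists_mirror hT
  · refine ⟨m, (hT.total_of_not_adj hm.not_adj).imp ?_ ?_⟩ <;> exact fun h' => Or.inl ⟨hm, h'⟩
  · have hxy := (hm.pairwise_adj hT).1
    refine ⟨m, (hT.total_of_not_adj hm.not_adj_fst).imp ?_ ?_⟩ <;>
      refine fun h' => Or.inr ⟨hm, h', ?_⟩
    · exact (hT.total_of_not_adj hm.not_adj_snd).resolve_right fun h'' =>
        hT.not_adj (hT.trans h' h'') hxy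
    · exact (hT.total_of_not_adj hm.not_adj_snd).resolve_left fun h'' =>
        hT.not_adj (hT.trans h'' h') (G.symm _ _ hxy)

/-! ### The leading selection -/

variable (G P) in
/-- The class of `(x, y)` contains an aligned pair. -/
def IsDirected (x y : V) : Prop :=
  ∃ e, G.Linked (x, y) e ∧ G.IsAligned P e.1 e.2

variable (G) in
/-- With respect to the ranking `f` of the vertices, the lexicographically first pair in the classes
of `(x, y)` and `(y, x)` lies in the class of `(x, y)`. -/
def IsLeading (f : V → ℕ) (x y : V) : Prop :=
  ∃ e, G.Linked (x, y) e ∧ ∀ e', G.Linked (x, y) e' ∨ G.Linked (y, x) e' →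
    toLex (f e.1, f e.2) ≤ toLex (f e'.1, f e'.2)

variable (G P) in
/-- The selection that follows alignment where there is any and otherwise contains the
lexicographically first pair of each class. -/
def leadingSelection (f : V → ℕ) (x y : V) : Prop :=
  (∃ p q, G.Forces (x, y) (p, q)) ∧
    (G.IsDirected P x y ∨ ¬ G.IsDirected P y x ∧ G.IsLeading f x y)

theorem IsDirected.of_linked {x y p q : V} (h : G.IsDirected P x y)
    (hl : G.Linked (x, y) (p, q)) : G.IsDirected P p q := by
  obtain ⟨e, h1, h2⟩ := h
  exact ⟨e, hl.symm.trans h1, h2⟩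

theorem IsSelection.isDirected_asymm (hT : G.IsSelection P T) {x y : V}
    (h : G.IsDirected P x y) : ¬ G.IsDirected P y x := by
  rintro ⟨e', h3, h4⟩
  obtain ⟨e, h1, h2⟩ := h
  exact hT.not_isAligned_of_linked h2 (h1.symm.trans h3.swap) h4

theorem IsLeading.of_linked {f : V → ℕ} {x y p q : V} (h : G.IsLeading f x y)
    (hl : G.Linked (x, y) (p, q)) : G.IsLeading f p q := by
  obtain ⟨e, h1, h2⟩ := h
  exact ⟨e, hl.symm.trans h1, fun e' he' => h2 e' (he'.imp hl.trans hl.swap_mk.trans)⟩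

theorem isAligned_of_base (hT : G.IsSelection P T) {x y : V} (h : P x y) : G.IsAligned P x y :=
  ⟨x, y, forces_self (hT.not_adj h), h, h⟩

theorem IsSelection.isSelection_leadingSelection (hT : G.IsSelection P T) {f : V → ℕ}
    (hf : Function.Injective f) : G.IsSelection P (G.leadingSelection P f) where
  not_adj := hT.not_adj
  total_of_not_adj := hT.total_of_not_adj
  trans := hT.trans
  of_base h := ⟨⟨_, _, forces_self (hT.not_adj h)⟩, Or.inl ⟨_, .refl, isAligned_of_base hT h⟩⟩
  forces h h' := by
    refine ⟨⟨_, _, h.symm⟩, h'.2.imp (fun h1 => h1.of_linked h.linked) fun h1 => ⟨fun h2 => ?_, ?_⟩⟩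
    · exact h1.1 (h2.of_linked h.linked.symm.swap_mk)
    · exact h1.2.of_linked h.linked
  asymm := by
    rintro x y ⟨⟨p, q, hpq⟩, h1 | ⟨h1, h2⟩⟩ ⟨-, h3 | ⟨h3, h4⟩⟩
    · exact hT.isDirected_asymm h1 h3
    · exact h3 h1
    · exact h1 h3
    · obtain ⟨e, he, he'⟩ := h2
      obtain ⟨k, hk, hk'⟩ := h4
      have hek := le_antisymm (he' k (Or.inr hk)) (hk' e (Or.inr he))
      have hek' : e = k := by
        simp only [toLex_inj, Prod.mk.injEq] at hek
        exact Prod.ext (hf hek.1) (hf hek.2)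
      subst hek'
      have hl : G.Linked (x, y) (y, x) := he.trans hk.symm
      rcases hT.total hpq with h | h
      · exact hT.asymm h (hT.linked hl h)
      · exact hT.asymm h (hT.linked hl.swap_mk h)
  exists_forces h := h.1
  total := by
    intro x y p q h
    by_cases h1 : G.IsDirected P x y
    · exact Or.inl ⟨⟨p, q, h⟩, Or.inl h1⟩
    by_cases h2 : G.IsDirected P y x
    · exact Or.inr ⟨⟨q, p, h.swap⟩, Or.inl h2⟩
    obtain ⟨e, he, hmin⟩ := WellFounded.has_min
      (InvImage.wf (fun e : V × V => toLex (f e.1, f e.2)) wellFounded_lt)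
      {e | G.Linked (x, y) e ∨ G.Linked (y, x) e} ⟨(x, y), Or.inl .refl⟩
    have hmin' : ∀ e', G.Linked (x, y) e' ∨ G.Linked (y, x) e' →
        toLex (f e.1, f e.2) ≤ toLex (f e'.1, f e'.2) := fun e' he' => not_lt.1 (hmin e' he')
    rcases he with he | he
    · exact Or.inl ⟨⟨p, q, h⟩, Or.inr ⟨h2, e, he, hmin'⟩⟩
    · exact Or.inr ⟨⟨q, p, h.swap⟩, Or.inr ⟨h1, e, he, fun e' he' => hmin' e' he'.symm⟩⟩

theorem leadingSelection_of_isAligned {f : V → ℕ} {a c : V} (h : G.IsAligned P a c) :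
    G.leadingSelection P f a c := by
  refine ⟨?_, Or.inl ⟨_, .refl, h⟩⟩
  obtain ⟨b, d, hf, -⟩ := h
  exact ⟨b, d, hf⟩

/-- The leading selection is acyclic. In a cyclic triangle `xyz` with `x` of least possible rank,
the class of `(z, x)` must contain a pair `(x, w)`, and then `y` comes both before and after `x`. -/
theorem IsSelection.not_isCyclic_leadingSelection (hT : G.IsSelection P T) {f : V → ℕ}
    (hf : Function.Injective f) (hPf : ∀ x y, P x y → f x < f y) (x y z : V) :
    ¬ IsCyclic (G.leadingSelection P f) x y z := by
  have hS := hT.isSelection_leadingSelection hf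
  have hA : ∀ a c, G.IsAligned P a c → G.leadingSelection P f a c :=
    fun _ _ => leadingSelection_of_isAligned
  induction hn : f x using Nat.strong_induction_on generalizing x y z with
  | _ n ih =>
  subst hn
  intro h
  have hmin : ∀ {a b c}, IsCyclic (G.leadingSelection P f) a b c → f x ≤ f a := fun {a b c} habc =>
    not_lt.1 fun h' => ih _ h' a b c rfl habc
  obtain ⟨m, hm | hm⟩ := h.rotate.rotate.isLow_or_isHigh hS
  swap
  · obtain ⟨p, q, hpq⟩ := hS.exists_forces h.thd
    obtain ⟨h1, -, h2⟩ := hm.step hS hA hpq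
    exact absurd (hPf _ _ h2) (not_lt.2 (hmin h1.isCyclic))
  rcases h.thd.2 with ⟨e, he, h1⟩ | ⟨-, e, he, h1⟩
  · rcases hm.linked hS hA he with h2 | h2
    · exact h2.not_isAligned hS hA h1
    · exact h2.not_isAligned hS hA h1
  · have hex : f e.1 ≤ f x := by
      have := h1 (x, z) (Or.inr .refl)
      rw [Prod.Lex.toLex_le_toLex] at this
      rcases this with h2 | h2
      · exact h2.le
      · exact h2.1.le
    rcases hm.linked hS hA he with h2 | h2
    · have : e.1 = x := hf (le_antisymm hex (hmin h2.isCyclic))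
      have h3 := h2.isCyclic.thd
      rw [this] at h3
      exact hS.asymm h.fst h3
    · obtain ⟨p, q, hpq⟩ := hS.exists_forces h2.isCyclic.fst
      obtain ⟨h3, h4, -⟩ := h2.step hS hA hpq
      have := hPf _ _ h4
      have := hmin h3.isCyclic.rotate
      omega

/-! ### Avoidance in terms of non-edges -/

theorem induces_of_injective {W : Type*} {S : Set V} {H : SimpleGraph W} (φ : W → V)
    (hinj : Function.Injective φ) (hS : ∀ x, x ∈ S ↔ ∃ w, φ w = x)
    (hadj : ∀ i j, H.Adj i j ↔ i ≠ j ∧ G.Adj (φ i) (φ j)) : G.Induces S H := by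
  refine ⟨RelIso.symm ⟨Equiv.ofBijective (fun w => ⟨φ w, (hS _).2 ⟨w, rfl⟩⟩) ⟨?_, ?_⟩, ?_⟩⟩
  · intro i j h
    exact hinj (congrArg Subtype.val h)
  · rintro ⟨x, hx⟩
    obtain ⟨w, rfl⟩ := (hS x).1 hx
    exact ⟨w, rfl⟩
  · intro i j
    change (φ i ≠ φ j ∧ G.Adj (φ i) (φ j)) ↔ H.Adj i j
    rw [hadj, hinj.ne_iff]

/-- In an induced copy of `H`, disjoint edges have their ends joined by two disjoint non-edges as
soon as this is so in `H`. -/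
theorem Induces.exists_not_adj {W : Type*} {H : SimpleGraph W}
    (hH : ∀ i j k l, H.Adj i j → H.Adj k l → i ≠ k → i ≠ l → j ≠ k → j ≠ l →
      ¬ H.Adj i l ∧ ¬ H.Adj j k ∨ ¬ H.Adj i k ∧ ¬ H.Adj j l)
    {u u' v v' : V} (h : G.Induces {u, u', v, v'} H) (hu : u ≠ u') (hv : v ≠ v')
    (huu : G.Adj u u') (hvv : G.Adj v v') (h1 : u ≠ v) (h2 : u ≠ v') (h3 : u' ≠ v) (h4 : u' ≠ v') :
    ¬ G.Adj u v' ∧ ¬ G.Adj u' v ∨ ¬ G.Adj u v ∧ ¬ G.Adj u' v' := by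
  obtain ⟨φ⟩ := h
  have key : ∀ a b : ({u, u', v, v'} : Set V), H.Adj (φ a) (φ b) ↔ a.1 ≠ b.1 ∧ G.Adj a.1 b.1 :=
    fun a b => φ.map_rel_iff
  have hne : ∀ a b : ({u, u', v, v'} : Set V), a.1 ≠ b.1 → φ a ≠ φ b := fun a b hab h' =>
    hab (congrArg Subtype.val (φ.injective h'))
  let a : ({u, u', v, v'} : Set V) := ⟨u, by simp⟩
  let b : ({u, u', v, v'} : Set V) := ⟨u', by simp⟩
  let c : ({u, u', v, v'} : Set V) := ⟨v, by simp⟩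
  let d : ({u, u', v, v'} : Set V) := ⟨v', by simp⟩
  have := hH (φ a) (φ b) (φ c) (φ d) ((key a b).2 ⟨hu, huu⟩) ((key c d).2 ⟨hv, hvv⟩)
    (hne a c h1) (hne a d h2) (hne b c h3) (hne b d h4)
  simp only [key, not_and] at this
  exact this.imp (fun h => ⟨h.1 h2, h.2 h3⟩) fun h => ⟨h.1 h1, h.2 h4⟩

theorem PairAvoids.exists_not_adj {u u' v v' : V} (huu : G.Adj u u') (hvv : G.Adj v v')
    (h : G.PairAvoids u u' v v') :
    ¬ G.Adj u v' ∧ ¬ G.Adj u' v ∨ ¬ G.Adj u v ∧ ¬ G.Adj u' v' := by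
  obtain ⟨hd, h⟩ := h
  have hne : ∀ a ∈ ({u, u'} : Set V), ∀ b ∈ ({v, v'} : Set V), a ≠ b := fun a ha b hb =>
    hd.ne_of_mem ha hb
  rcases h with ⟨rfl, rfl, h⟩ | ⟨rfl, -, h⟩ | ⟨-, rfl, h⟩ | ⟨hu, hv, h⟩
  · exact Or.inl ⟨h, h⟩
  · exact Or.inl h.symm
  · exact Or.inl h
  · have h1 := hne u (by simp) v (by simp)
    have h2 := hne u (by simp) v' (by simp)
    have h3 := hne u' (by simp) v (by simp)
    have h4 := hne u' (by simp) v' (by simp)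
    rcases h with h | h | h
    · refine h.exists_not_adj ?_ hu hv huu hvv h1 h2 h3 h4
      rintro (i | i) (j | j) (k | k) (l | l) <;> simp <;> omega
    · refine h.exists_not_adj ?_ hu hv huu hvv h1 h2 h3 h4
      simp only [SimpleGraph.pathGraph_adj]
      decide
    · refine h.exists_not_adj ?_ hu hv huu hvv h1 h2 h3 h4
      simp only [SimpleGraph.cycleGraph_adj]
      decide

theorem Forces.pairAvoids {a b c d : V} (h : G.Forces (a, c) (b, d)) : G.PairAvoids a b c d := by
  obtain ⟨hab, hcd, had, hcb⟩ := h
  dsimp only at *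
  have hs := G.symm
  have hac : a ≠ c := by rintro rfl; exact hcb hab
  have had' : a ≠ d := by rintro rfl; exact had (G.refl _)
  have hbc : b ≠ c := by rintro rfl; exact hcb (G.refl _)
  have hbd : b ≠ d := by rintro rfl; exact had hab
  refine ⟨?_, ?_⟩
  · rw [Set.disjoint_left]
    simp only [Set.mem_insert_iff, Set.mem_singleton_iff]
    rintro x (rfl | rfl) (h | h)
    exacts [hac h, had' h, hbc h, hbd h]
  by_cases h1 : a = b
  · subst h1
    by_cases h2 : c = d
    · exact Or.inl ⟨rfl, h2, fun h => hcb (hs _ _ h)⟩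
    · exact Or.inr (Or.inl ⟨rfl, h2, fun h => hcb (hs _ _ h), had⟩)
  by_cases h2 : c = d
  · subst h2
    exact Or.inr (Or.inr (Or.inl ⟨h1, rfl, had, fun h => hcb (hs _ _ h)⟩))
  refine Or.inr (Or.inr (Or.inr ⟨h1, h2, ?_⟩))
  have e1 : G.Adj b a := hs _ _ hab
  have e2 : G.Adj d c := hs _ _ hcd
  have e3 : ¬ G.Adj d a := fun h => had (hs _ _ h)
  have e4 : ¬ G.Adj b c := fun h => hcb (hs _ _ h)
  have n1 := Ne.symm h1
  have n2 := Ne.symm h2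
  have n3 := hac.symm
  have n4 := had'.symm
  have n5 := hbc.symm
  have n6 := hbd.symm
  by_cases h3 : G.Adj a c
  · have h3' := hs _ _ h3
    -- The vertices form the path `b a c d`, closed to a cycle if `b` and `d` are adjacent.
    have hinj : Function.Injective ![b, a, c, d] := by
      intro i j
      fin_cases i <;> fin_cases j <;> simp [*]
    have hmem : ∀ x, x ∈ ({a, b, c, d} : Set V) ↔ ∃ w, ![b, a, c, d] w = x := by
      intro x
      simp [Fin.exists_fin_succ]
      grind
    by_cases h4 : G.Adj b d
    · have h4' := hs _ _ h4
      refine Or.inr (Or.inr (induces_of_injective ![b, a, c, d] hinj hmem ?_))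
      intro i j
      fin_cases i <;> fin_cases j <;> simp [*, SimpleGraph.cycleGraph_adj] <;> decide
    · have h4' : ¬ G.Adj d b := fun h => h4 (hs _ _ h)
      refine Or.inr (Or.inl (induces_of_injective ![b, a, c, d] hinj hmem ?_))
      intro i j
      fin_cases i <;> fin_cases j <;> simp [*, SimpleGraph.pathGraph_adj]
  have h3' : ¬ G.Adj c a := fun h => h3 (hs _ _ h)
  by_cases h4 : G.Adj b d
  · have h4' := hs _ _ h4
    have hinj : Function.Injective ![a, b, d, c] := by
      intro i j
      fin_cases i <;> fin_cases j <;> simp [*]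
    refine Or.inr (Or.inl (induces_of_injective ![a, b, d, c] hinj ?_ ?_))
    · intro x
      simp [Fin.exists_fin_succ]
      grind
    · intro i j
      fin_cases i <;> fin_cases j <;> simp [*, SimpleGraph.pathGraph_adj]
  · have h4' : ¬ G.Adj d b := fun h => h4 (hs _ _ h)
    refine Or.inl (induces_of_injective (Sum.elim ![a, b] ![c, d]) ?_ ?_ ?_)
    · rintro (i | i) (j | j) <;> fin_cases i <;> fin_cases j <;> simp [*]
    · intro x
      simp [Fin.exists_fin_succ]
      grind
    · rintro (i | i) (j | j) <;> fin_cases i <;> fin_cases j <;> simp [*]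

/-- Two edges avoid each other exactly when their ends can be labelled so that the two pairs of
ends force one another. -/
theorem avoids_iff {e f : G.edgeSet} : G.Avoids e f ↔
    ∃ a b c d, (e : Sym2 V) = s(a, b) ∧ (f : Sym2 V) = s(c, d) ∧ G.Forces (a, c) (b, d) := by
  constructor
  · rintro ⟨u, u', v, v', he, hf, h⟩
    have huu : G.Adj u u' := by
      have := e.2
      rwa [he] at this
    have hvv : G.Adj v v' := by
      have := f.2
      rwa [hf] at this
    rcases h.exists_not_adj huu hvv with h1 | h1
    · exact ⟨u, u', v, v', he, hf, huu, hvv, h1.1, fun h' => h1.2 (G.symm _ _ h')⟩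
    · exact ⟨u, u', v', v, he, hf.trans Sym2.eq_swap, huu, G.symm _ _ hvv, h1.1,
        fun h' => h1.2 (G.symm _ _ h')⟩
  · rintro ⟨a, b, c, d, he, hf, h⟩
    exact ⟨a, b, c, d, he, hf, h.pairAvoids⟩

/-! ### Slash-free orderings -/

variable (G) in
theorem isStrongCocomparabilityGraph_iff :
    G.IsStrongCocomparabilityGraph ↔ ∃ (n : ℕ) (σ : Fin n ≃ V), ∀ a c b d,
      G.Forces (a, c) (b, d) → σ.symm a < σ.symm c → σ.symm b < σ.symm d := by
  have hM : ∀ {n : ℕ} (σ : Fin n ≃ V) (i j : Fin n),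
      ((G.adjMatrix.submatrix σ σ) i j = 1 ↔ G.Adj (σ i) (σ j)) ∧
      ((G.adjMatrix.submatrix σ σ) i j = 0 ↔ ¬ G.Adj (σ i) (σ j)) := by
    intro n σ i j
    by_cases h : G.Adj (σ i) (σ j) <;> simp [adjMatrix, h]
  constructor
  · rintro ⟨n, σ, h⟩
    refine ⟨n, σ, fun a c b d hf hac => ?_⟩
    obtain ⟨h1, h2, h3, h4⟩ := hf
    dsimp only at *
    by_contra hbd
    have hne : b ≠ d := by rintro rfl; exact h3 h1
    have hdb : σ.symm d < σ.symm b := lt_of_le_of_ne (not_lt.1 hbd) fun h' =>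
      hne (σ.symm.injective h').symm
    have hmono : ∀ {i j : Fin n}, i < j → StrictMono ![i, j] := fun hij => by
      rw [Fin.strictMono_iff_lt_succ]
      intro k
      fin_cases k
      simpa using hij
    refine h ⟨OrderEmbedding.ofStrictMono _ (hmono hac), OrderEmbedding.ofStrictMono _ (hmono hdb),
      ?_⟩
    ext i j
    fin_cases i <;> fin_cases j <;> simp [slashMatrix, adjMatrix, h1, h2, h3, h4]
  · rintro ⟨n, σ, h⟩
    refine ⟨n, σ, ?_⟩
    rintro ⟨row, col, hS⟩
    have e : ∀ i j, (G.adjMatrix.submatrix σ σ) (row i) (col j) = slashMatrix i j := fun i j =>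
      congrFun (congrFun hS i) j
    have e00 := ((hM σ _ _).2).1 (e 0 0)
    have e01 := ((hM σ _ _).1).1 (e 0 1)
    have e10 := ((hM σ _ _).1).1 (e 1 0)
    have e11 := ((hM σ _ _).2).1 (e 1 1)
    have := h _ _ _ _ (Forces.mk e01 e10 e00 e11) (by simp)
    simp at this

/-- A transitive and asymmetric relation on a finite type is compatible with some enumeration. -/
theorem exists_enumeration [Finite V] {R : V → V → Prop} (htrans : ∀ x y z, R x y → R y z → R x z)
    (hasymm : ∀ x y, R x y → ¬ R y x) :
    ∃ (n : ℕ) (σ : Fin n ≃ V), ∀ x y, R x y → σ.symm x < σ.symm y := by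
  have := Fintype.ofFinite V
  let r : V → V → Prop := fun x y => x = y ∨ R x y
  have : IsPartialOrder V r :=
    { refl := fun x => Or.inl rfl
      trans := by
        rintro x y z (rfl | h1) (rfl | h2)
        · exact Or.inl rfl
        · exact Or.inr h2
        · exact Or.inr h1
        · exact Or.inr (htrans _ _ _ h1 h2)
      antisymm := by
        rintro x y (rfl | h1) (h2 | h2)
        · rfl
        · rfl
        · exact h2.symm
        · exact absurd h2 (hasymm _ _ h1) }
  obtain ⟨s, hs, hrs⟩ := extend_partialOrder r
  classical
  let : LinearOrder V :=
    { le := s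
      le_refl := hs.refl
      le_trans := hs.trans
      le_antisymm := hs.antisymm
      le_total := hs.total
      toDecidableLE := Classical.decRel _ }
  let σ : Fin (Fintype.card V) ≃o V := monoEquivOfFin V rfl
  refine ⟨_, σ.toEquiv, fun x y hxy => σ.symm.strictMono (lt_of_le_of_ne (hrs _ _ (Or.inr hxy)) ?_)⟩
  rintro rfl
  exact hasymm _ _ hxy hxy

/-! ### From an ordering to a transitive orientation -/

theorem IsStrongCocomparabilityGraph.isComparabilityGraph
    (h : G.IsStrongCocomparabilityGraph) : G.avoidanceGraph.IsComparabilityGraph := by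
  obtain ⟨n, σ, hσ⟩ := (isStrongCocomparabilityGraph_iff G).1 h
  refine ⟨fun e f => ∃ a b c d, (e : Sym2 V) = s(a, b) ∧ (f : Sym2 V) = s(c, d) ∧
    G.Forces (a, c) (b, d) ∧ σ.symm a < σ.symm c ∧ σ.symm b < σ.symm d, ?_, ?_, ?_⟩
  · intro e f
    change G.Avoids e f ↔ _
    rw [avoids_iff]
    constructor
    · rintro ⟨a, b, c, d, he, hf, hF⟩
      have hac : σ.symm a ≠ σ.symm c := fun h' =>
        hF.2.2.2 (by simpa [σ.symm.injective h'] using hF.1)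
      rcases lt_or_gt_of_ne hac with h' | h'
      · exact Or.inl ⟨a, b, c, d, he, hf, hF, h', hσ _ _ _ _ hF h'⟩
      · exact Or.inr ⟨c, d, a, b, hf, he, hF.swap, h', hσ _ _ _ _ hF.swap h'⟩
    · rintro (⟨a, b, c, d, he, hf, hF, -⟩ | ⟨c, d, a, b, hf, he, hF, -⟩)
      · exact ⟨a, b, c, d, he, hf, hF⟩
      · exact ⟨a, b, c, d, he, hf, hF.swap⟩
  · -- An arc increases the sum of the positions of the two ends.
    rintro e f ⟨a, b, c, d, he, hf, -, h1, h2⟩ ⟨c', d', a', b', hf', he', -, h3, h4⟩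
    rw [he, Sym2.eq_iff] at he'
    rw [hf, Sym2.eq_iff] at hf'
    rcases he' with ⟨rfl, rfl⟩ | ⟨rfl, rfl⟩ <;> rcases hf' with ⟨rfl, rfl⟩ | ⟨rfl, rfl⟩ <;> omega
  · suffices ∀ (e g : G.edgeSet) (a b c d x y : V), (e : Sym2 V) = s(a, b) →
        (g : Sym2 V) = s(x, y) → G.Forces (a, c) (b, d) → G.Forces (c, x) (d, y) →
        σ.symm a < σ.symm c → σ.symm b < σ.symm d → σ.symm c < σ.symm x → σ.symm d < σ.symm y →
        ∃ a b c d, (e : Sym2 V) = s(a, b) ∧ (g : Sym2 V) = s(c, d) ∧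
          G.Forces (a, c) (b, d) ∧ σ.symm a < σ.symm c ∧ σ.symm b < σ.symm d by
      rintro e f g ⟨a, b, c, d, he, hf, h1, h2, h3⟩ ⟨c', d', x, y, hf', hg, h4, h5, h6⟩
      rw [hf, Sym2.eq_iff] at hf'
      rcases hf' with ⟨rfl, rfl⟩ | ⟨rfl, rfl⟩
      · exact this e g a b c d x y he hg h1 h4 h2 h3 h5 h6
      · exact this e g a b c d y x he (hg.trans Sym2.eq_swap) h1 h4.symm h2 h3 h6 h5
    intro e g a b c d x y he hg h1 h2 h3 h4 h5 h6
    refine ⟨a, b, x, y, he, hg, ⟨h1.1, h2.2.1, fun h' => ?_, fun h' => ?_⟩, h3.trans h5,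
      h4.trans h6⟩
    · exact lt_asymm h6 (hσ a c y d (Forces.mk h' h1.2.1 h1.2.2.1 h2.2.2.1) h3)
    · exact lt_asymm h5 (hσ b d x c (Forces.mk (G.symm _ _ h') (G.symm _ _ h1.2.1)
        (fun h'' => h1.2.2.2 (G.symm _ _ h'')) fun h'' => h2.2.2.2 (G.symm _ _ h'')) h4)

/-! ### From a transitive orientation to an ordering -/

/-- A transitive orientation of the avoidance graph yields a selection: `x` precedes `y` when an
edge `xp` has an arc to an edge `yq` such that `(x, y)` forces `(p, q)`. -/
theorem exists_isSelection (h : G.avoidanceGraph.IsComparabilityGraph) :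
    ∃ P T, G.IsSelection P T := by
  obtain ⟨arc', hadj, hasymm, htrans⟩ := h
  let arc : V → V → V → V → Prop := fun x p y q =>
    ∃ (h1 : s(x, p) ∈ G.edgeSet) (h2 : s(y, q) ∈ G.edgeSet), arc' ⟨_, h1⟩ ⟨_, h2⟩
  have hmem : ∀ {x p}, G.Adj x p → s(x, p) ∈ G.edgeSet := fun h => h
  have arc_total : ∀ {x p y q}, G.Forces (x, y) (p, q) → arc x p y q ∨ arc y q x p := by
    intro x p y q hf
    have h1 : G.Avoids ⟨_, hmem hf.1⟩ ⟨_, hmem hf.2.1⟩ := avoids_iff.2 ⟨_, _, _, _, rfl, rfl, hf⟩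
    exact ((hadj _ _).1 h1).imp (fun h => ⟨_, _, h⟩) fun h => ⟨_, _, h⟩
  have arc_avoids : ∀ {x p y q}, arc x p y q → G.Forces (x, y) (p, q) ∨
      G.Forces (x, q) (p, y) := by
    rintro x p y q ⟨h1, h2, h⟩
    obtain ⟨a, b, c, d, he, hf, hF⟩ := avoids_iff.1 ((hadj _ _).2 (Or.inl h))
    rw [Sym2.eq_iff] at he hf
    rcases he with ⟨rfl, rfl⟩ | ⟨rfl, rfl⟩ <;> rcases hf with ⟨rfl, rfl⟩ | ⟨rfl, rfl⟩
    · exact Or.inl hF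
    · exact Or.inr hF
    · exact Or.inr hF.symm
    · exact Or.inl hF.symm
  have arc_asymm : ∀ {x p y q}, arc x p y q → ¬ arc y q x p := by
    rintro x p y q ⟨_, _, h1⟩ ⟨_, _, h2⟩
    exact hasymm _ _ h1 h2
  have arc_trans : ∀ {x p y q z r}, arc x p y q → arc y q z r → arc x p z r := by
    rintro x p y q z r ⟨h1, _, h3⟩ ⟨_, h2, h4⟩
    exact ⟨h1, h2, htrans _ _ _ h3 h4⟩
  have arc_swap : ∀ {x p y q}, arc x p y q → arc p x q y := by
    rintro x p y q ⟨h1, h2, h3⟩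
    simp only [Sym2.eq_swap (a := x), Sym2.eq_swap (a := y)] at h3
    exact ⟨_, _, h3⟩
  have arc_irrefl : ∀ {x p q}, ¬ arc x p x q := by
    intro x p q h
    rcases arc_avoids h with h | h
    · exact h.2.2.2 h.1
    · exact h.2.2.1 (G.refl x)
  -- The direction of an arc depends only on the pair `(x, y)`, not on the other ends `p` and `q`.
  have arc_indep : ∀ {x p y q p' q'}, G.Forces (x, y) (p', q') → G.Forces (x, y) (p, q) →
      arc x p y q → arc x p' y q' := by
    intro x p y q p' q' h1 h2 h3
    refine (arc_total h1).resolve_right fun h4 => ?_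
    rcases arc_total (Forces.mk h2.1 h1.2.1 h1.2.2.1 h2.2.2.2) with h5 | h5
    · exact arc_irrefl (arc_trans h5 h4)
    · exact arc_irrefl (arc_trans h5 h3)
  let T : V → V → Prop := fun x y => ∃ p q, G.Forces (x, y) (p, q) ∧ arc x p y q
  have T_asymm : ∀ {x y}, T x y → ¬ T y x := by
    rintro x y ⟨p, q, h1, h2⟩ ⟨q', p', h3, h4⟩
    exact arc_asymm (arc_indep h3.swap h1 h2) h4
  have T_total : ∀ {x y p q}, G.Forces (x, y) (p, q) → T x y ∨ T y x := fun h =>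
    (arc_total h).imp (fun h' => ⟨_, _, h, h'⟩) fun h' => ⟨_, _, h.swap, h'⟩
  have loop : ∀ {x y}, ¬ G.Adj x y → T x y → arc x x y y := by
    rintro x y hn ⟨p, q, h1, h2⟩
    exact arc_indep (forces_self hn) h1 h2
  refine ⟨fun x y => ¬ G.Adj x y ∧ T x y, T, ?_, ?_, ?_, ?_, ?_, T_asymm, ?_, T_total⟩
  · exact fun h => h.1
  · exact fun h => (T_total (forces_self h)).imp (fun h' => ⟨h, h'⟩)
      fun h' => ⟨fun h'' => h (G.symm _ _ h''), h'⟩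
  · rintro x y z ⟨h1, h2⟩ ⟨h3, h4⟩
    have h5 := arc_trans (loop h1 h2) (loop h3 h4)
    have h6 : G.Forces (x, z) (x, z) := by
      rcases arc_avoids h5 with h | h <;> exact h
    exact ⟨h6.2.2.1, _, _, h6, h5⟩
  · exact fun h => h.2
  · rintro x y p q h ⟨p', q', h1, h2⟩
    exact ⟨x, y, h.symm, arc_swap (arc_indep h h1 h2)⟩
  · rintro x y ⟨p, q, h, -⟩
    exact ⟨p, q, h⟩

theorem isStrongCocomparabilityGraph_of_isComparabilityGraph [Finite V]
    (h : G.avoidanceGraph.IsComparabilityGraph) : G.IsStrongCocomparabilityGraph := by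
  obtain ⟨P, T, hT⟩ := exists_isSelection h
  obtain ⟨k, ρ, hρ⟩ := exists_enumeration (R := P) (fun _ _ _ => hT.trans) fun _ _ => hT.base_asymm
  have hinj : Function.Injective fun x => (ρ.symm x : ℕ) :=
    Fin.val_injective.comp ρ.symm.injective
  have hS := hT.isSelection_leadingSelection hinj
  have hcyc := hT.not_isCyclic_leadingSelection hinj hρ
  obtain ⟨n, σ, hσ⟩ := exists_enumeration
    (R := G.leadingSelection P fun x => ρ.symm x) (fun _ _ _ => hS.transitive hcyc)
    fun _ _ => hS.asymm
  refine (isStrongCocomparabilityGraph_iff G).2 ⟨n, σ, fun a c b d hF hac => ?_⟩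
  rcases hS.total hF with h | h
  · exact hσ _ _ (hS.forces hF h)
  · exact absurd (hσ _ _ h) (lt_asymm hac)

end ReflexiveGraph

theorem theorem7 {V : Type*} [Finite V] (G : ReflexiveGraph V) :
    G.IsStrongCocomparabilityGraph ↔ G.avoidanceGraph.IsComparabilityGraph :=
  ⟨fun h => h.isComparabilityGraph,
    ReflexiveGraph.isStrongCocomparabilityGraph_of_isComparabilityGraph⟩
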